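/- Let $N\ge 0$ be an integer, let $\mathcal E_1\le\dots\le\mathcal E_N$ be real numbers with $\sum_i\mathcal E_i=0$, let $A=-i\,\mathrm{diag}(\mathcal E_1,\dots,\mathcal E_N)$, and let $B=(b_{ij})\in\mathfrak{su}(N)$, i.e. $B$ is a complex $N\times N$ matrix that is skew-Hermitian and traceless. Consider the control system $$\dot X(t)=\bigl(A+u(t)B\bigr)X(t),\qquad X(t)\in SU(N),\qquad X(0)=I,$$ with real-valued piecewise constant controls $u$ (a trajectory on $[0,T]$ is a continuous curve in $SU(N)$ that satisfies the equation except at finitely many times). The system is called controllable if every element of $SU(N)$ equals $X(T)$ for some $T\ge 0$, some control $u$ on $[0,T]$ and a corresponding trajectory $X$. For $i\ne j$ let $\alpha_{ij}$ be the root of $\mathfrak{sl}_N(\mathbb C)$ given by $\mathrm{diag}(\lambda_1,\dots,\lambda_N)\mapsto\lambda_i-\lambda_j$ (on traceless diagonal matrices). Let $\Delta=\{\alpha_{ij}: i\ne j\}$, let $\Delta^+=\{\alpha_{ij}: i<j\}$ be the set of positive roots, and let $\Phi$ be the set of fundamental roots, i.e. of the positive roots that are not the sum of two positive roots; thus $\Phi=\{\alpha_{12},\alpha_{23},\dots,\alpha_{N-1,N}\}$.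 Write $A=iH$, so that $H=-\mathrm{diag}(\mathcal E_1,\dots,\mathcal E_N)$ and $\alpha_{ij}(H)=\mathcal E_j-\mathcal E_i$. A positive root $\alpha_{ij}$ is touched by $B$ if $b_{ij}\neq 0$. A positive root $\alpha$ is regular for $A$ if $\alpha(H)\ne0$ and $\beta(H)\neq\alpha(H)$ for every root $\beta\in\Delta$ with $\beta\ne\alpha$. Let $\Theta_A^+$ be the set of positive roots that are touched by $B$ and regular for $A$. If $\Phi\subseteq\Theta_A^+$, i.e. every fundamental root is touched by $B$ and regular for $A$, then the system is controllable. -/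

import Mathlib

namespace QControl

/-- Real traceless diagonal `N × N` matrices `diag(x₁, …, x_N)`, recorded by their diagonals: the
real form on which the roots of `A_{N-1}` take real values. -/
def realCartan (N : ℕ) : Submodule ℝ (Fin N → ℝ) :=
  LinearMap.ker (∑ i : Fin N, (LinearMap.proj i : (Fin N → ℝ) →ₗ[ℝ] ℝ))

/-- The functional `α_{ij} : diag(x) ↦ x_i - x_j`. -/
def root {N : ℕ} (i j : Fin N) : Module.Dual ℝ (realCartan N) :=
  ((LinearMap.proj i : (Fin N → ℝ) →ₗ[ℝ] ℝ) - LinearMap.proj j).comp (realCartan N).subtype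

/-- The set `Δ` of nonzero roots. -/
def roots (N : ℕ) : Set (Module.Dual ℝ (realCartan N)) :=
  {α | ∃ i j : Fin N, i ≠ j ∧ α = root i j}

/-- The set `Δ⁺` of positive roots. -/
def posRoots (N : ℕ) : Set (Module.Dual ℝ (realCartan N)) :=
  {α | ∃ i j : Fin N, i < j ∧ α = root i j}

/-- The set `Φ` of fundamental roots: the positive roots that are not the sum of two positive
roots (these are the roots `α_{i,i+1}`). -/
def fundamentalRoots (N : ℕ) : Set (Module.Dual ℝ (realCartan N)) :=
  {α ∈ posRoots N | ∀ β ∈ posRoots N, ∀ γ ∈ posRoots N, α ≠ β + γ}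

/-- The Lie algebra `𝔰𝔲(N)` (as a set): skew-Hermitian traceless matrices. -/
def su (N : ℕ) : Set (Matrix (Fin N) (Fin N) ℂ) :=
  {M | M.conjTranspose = -M ∧ M.trace = 0}

/-- The drift `A = -i diag(E₁, …, E_N)` with energy levels `E`. -/
noncomputable def drift {N : ℕ} (E : realCartan N) : Matrix (Fin N) (Fin N) ℂ :=
  Matrix.diagonal fun k => -Complex.I * ((E : Fin N → ℝ) k : ℂ)

/-- The set `Γ⁺` of positive roots touched by `B`. For skew-Hermitian `B` and `i < j`, the
coefficients of `B` along `X_{ij} = E_{ij} - E_{ji}` and `Y_{ij} = i (E_{ij} + E_{ji})` are the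
real and imaginary parts of the entry `B i j`. -/
def touchedRoots {N : ℕ} (B : Matrix (Fin N) (Fin N) ℂ) : Set (Module.Dual ℝ (realCartan N)) :=
  {α | ∃ i j : Fin N, i < j ∧ B i j ≠ 0 ∧ α = root i j}

/-- The set `Π⁺_A` of positive roots that are regular for `A = drift E`: their value at `A` is
nonzero and different from the value of every other root. Roots are evaluated at the matrix
`H = -diag(E)` for which `A = i H`, so that `α_{ij}` has the value `E_j - E_i`. -/
def regularPosRoots {N : ℕ} (E : realCartan N) : Set (Module.Dual ℝ (realCartan N)) :=
  {α ∈ posRoots N | α (-E) ≠ 0 ∧ ∀ β ∈ roots N, β ≠ α → β (-E) ≠ α (-E)}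

/-- `Θ⁺_A = Γ⁺ ∩ Π⁺_A`. -/
def touchedRegularRoots {N : ℕ} (E : realCartan N) (B : Matrix (Fin N) (Fin N) ℂ) :
    Set (Module.Dual ℝ (realCartan N)) :=
  touchedRoots B ∩ regularPosRoots E

/-- `u` is piecewise constant on `[0, T]`: there are finitely many points such that `u` is constant
on every subinterval that contains none of them. -/
def IsPiecewiseConstant (u : ℝ → ℝ) (T : ℝ) : Prop :=
  ∃ F : Finset ℝ, ∀ s t : ℝ, 0 ≤ s → s ≤ t → t ≤ T → (∀ r ∈ F, r ∉ Set.Icc s t) → u s = u t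

/-- `X` is an integral curve on `[0, T]`, starting at the identity, of the control system
`X' = (A + u(t) B) X` on `SU(N)`: it is continuous and satisfies the equation (entry by entry)
except at finitely many times. -/
def IsTrajectory {N : ℕ} (A B : Matrix (Fin N) (Fin N) ℂ) (u : ℝ → ℝ) (T : ℝ)
    (X : ℝ → Matrix.specialUnitaryGroup (Fin N) ℂ) : Prop :=
  X 0 = 1 ∧ ContinuousOn X (Set.Icc 0 T) ∧
    ∃ F : Finset ℝ, ∀ t ∈ Set.Ioo 0 T, t ∉ F → ∀ i j : Fin N,
      HasDerivAt (fun s => (X s : Matrix (Fin N) (Fin N) ℂ) i j)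
        (((A + (u t : ℂ) • B) * (X t : Matrix (Fin N) (Fin N) ℂ)) i j) t

/-- The set of all points of `SU(N)` reachable from the identity in some time `T ≥ 0`. -/
def reachableSet {N : ℕ} (A B : Matrix (Fin N) (Fin N) ℂ) :
    Set (Matrix.specialUnitaryGroup (Fin N) ℂ) :=
  {Z | ∃ T : ℝ, 0 ≤ T ∧ ∃ u : ℝ → ℝ, IsPiecewiseConstant u T ∧
    ∃ X : ℝ → Matrix.specialUnitaryGroup (Fin N) ℂ, IsTrajectory A B u T X ∧ X T = Z}

/-- (Global) controllability: the reachable set is the whole group. -/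
def Controllable {N : ℕ} (A B : Matrix (Fin N) (Fin N) ℂ) : Prop :=
  reachableSet A B = Set.univ

end QControl

/-!
Concatenating the flows of the fields `X ↦ (A + c B) X`, each followed forward in time, gives a
monoid of reachable points. Among all differentiable families of its elements take one whose space
of velocities `T` at some point `g` has maximal dimension. Prolonging the family by one more flow
cannot enlarge `T`, so `g⁻¹ T g` contains the span of the conjugates of all fields by the monoid.
This span is stable under the brackets with the fields, hence contains the Lie algebra they
generate. If that is `su N`, the family fills a neighbourhood of `g` in `SU(N)`, and a submonoid of
a compact connected group with nonempty interior is the whole group: its closure is a group, since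
in a compact group the inverse of an element is a limit of its powers.

It remains to generate `su N`. The operator `ad A` multiplies the `(j, k)` entry by `i (E_k - E_j)`,
so a suitable polynomial in `ad A` isolates from `B` the entry at a touched regular root and
rescales it by any complex number. The brackets of these two-level matrices along paths of a
connected graph on the levels give all two-level matrices, and these generate `su N`.
-/

open Filter Topology Module

namespace QControl

section CompactGroup

theorem submonoid_eq_top_of_mem_nhds {G : Type*} [Group G] [TopologicalSpace G]
    [IsTopologicalGroup G] [CompactSpace G] [ConnectedSpace G] {S : Submonoid G} {g : G}
    (hg : (S : Set G) ∈ 𝓝 g) : S = ⊤ := by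
  have hclosure : closure (S : Set G) = closure (Subgroup.closure (S : Set G) : Set G) := by
    simpa only [Submonoid.closure_eq] using
      closure_submonoidClosure_eq_closure_subgroupClosure (S : Set G)
  have hopen : IsOpen (Subgroup.closure (S : Set G) : Set G) :=
    Subgroup.isOpen_of_mem_nhds _ (mem_of_superset hg Subgroup.subset_closure)
  have hgenerates : (Subgroup.closure (S : Set G) : Set G) = Set.univ :=
    IsClopen.eq_univ ⟨Subgroup.isClosed_of_isOpen _ hopen, hopen⟩ ⟨1, one_mem _⟩
  have hdense : Dense (S : Set G) := by
    rw [dense_iff_closure_eq, hclosure, hgenerates, closure_univ]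
  refine eq_top_iff.2 fun x _ => ?_
  have hnhds : (fun y => y⁻¹ * x) ⁻¹' (S : Set G) ∈ 𝓝 (x * g⁻¹) :=
    ContinuousAt.preimage_mem_nhds (by fun_prop) (by simpa using hg)
  obtain ⟨y, hy, hyS⟩ := hdense.inter_nhds_nonempty hnhds
  simpa using S.mul_mem hy hyS

end CompactGroup

section LevelSet

variable {E V W : Type*} [NormedAddCommGroup E] [NormedSpace ℝ E]
  [NormedAddCommGroup V] [NormedSpace ℝ V] [FiniteDimensional ℝ V]
  [NormedAddCommGroup W] [NormedSpace ℝ W]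

theorem eventually_eq_of_sub_mem_of_apply_eq {ρ : V → W} {ρ' : V →L[ℝ] W} {x : V}
    (hρ : HasStrictFDerivAt ρ ρ' x) {C : Submodule ℝ V} (hC : Disjoint C ρ'.ker) :
    ∀ᶠ q : V × V in 𝓝 (x, x), q.1 - q.2 ∈ C → ρ q.1 = ρ q.2 → q.1 = q.2 := by
  obtain ⟨K, hK, hKC⟩ := (ρ'.toLinearMap.domRestrict C).exists_antilipschitzWith
    (LinearMap.ker_eq_bot.2 (LinearMap.injective_domRestrict_iff.2 hC))
  have hbound : ∀ c ∈ C, ‖c‖ ≤ K * ‖ρ' c‖ := fun c hc =>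
    ZeroHomClass.bound_of_antilipschitz _ hKC ⟨c, hc⟩
  have hsmall := hρ.isLittleO.def (c := (K : ℝ)⁻¹ / 2) (by positivity)
  filter_upwards [hsmall] with q hq hqC hqρ
  rw [hqρ, sub_self, zero_sub, norm_neg] at hq
  have hle : ‖q.1 - q.2‖ ≤ ‖q.1 - q.2‖ / 2 := calc
    ‖q.1 - q.2‖ ≤ K * ‖ρ' (q.1 - q.2)‖ := hbound _ hqC
    _ ≤ K * ((K : ℝ)⁻¹ / 2 * ‖q.1 - q.2‖) := mul_le_mul_of_nonneg_left hq K.2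
    _ = ‖q.1 - q.2‖ / 2 := by field_simp
  have hzero : ‖q.1 - q.2‖ = 0 := by linarith [norm_nonneg (q.1 - q.2)]
  exact sub_eq_zero.1 (norm_eq_zero.1 hzero)

theorem nhdsWithin_levelSet_le_map_nhds [CompleteSpace E] {F : E → V} {F' : E →L[ℝ] V} {p : E}
    (hF : HasStrictFDerivAt F F' p) {ρ : V → W} {ρ' : V →L[ℝ] W}
    (hρ : HasStrictFDerivAt ρ ρ' (F p)) (hρF : ∀ᶠ q in 𝓝 p, ρ (F q) = ρ (F p))
    (hker : ρ'.ker ≤ F'.range) :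
    𝓝[ρ ⁻¹' {ρ (F p)}] F p ≤ map F (𝓝 p) := by
  -- Adding a complement of `ker ρ'` turns `F` into a submersion, and moving in the direction of
  -- this complement changes the value of `ρ`.
  obtain ⟨C, hC⟩ := ρ'.ker.exists_isCompl
  let G : E × C → V := fun q => F q.1 + q.2
  have hG : HasStrictFDerivAt G (F'.coprod C.subtypeL) (p, 0) := by
    have hcomp : HasStrictFDerivAt (fun q : E × C => F q.1) _ (p, 0) :=
      HasStrictFDerivAt.comp (p, 0) (g := F) (f := Prod.fst) hF hasStrictFDerivAt_fst
    exact (hcomp.add (C.subtypeL.comp (.snd ℝ E C)).hasStrictFDerivAt).congr_fderiv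
      (by ext <;> simp)
  have hsurj : (F'.coprod C.subtypeL).range = ⊤ := by
    rw [ContinuousLinearMap.range_coprod]
    simpa using top_le_iff.1 (hC.sup_eq_top.symm.le.trans (sup_le_sup_right hker C))
  have hGp : G (p, 0) = F p := by simp [G]
  have hmap : map G (𝓝 (p, 0)) = 𝓝 (F p) := hGp ▸ hG.map_nhds_eq_of_surj hsurj
  intro U hU
  have hfst : Tendsto Prod.fst (𝓝 ((p, 0) : E × C)) (𝓝 p) := continuous_fst.tendsto _
  have hpair : Tendsto (fun q : E × C => (G q, F q.1)) (𝓝 (p, 0)) (𝓝 (F p, F p)) :=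
    Tendsto.prodMk_nhds hmap.le (hF.continuousAt.tendsto.comp hfst)
  have hlevel : ∀ᶠ q in 𝓝 ((p, 0) : E × C), ρ (G q) = ρ (F p) → G q ∈ U := by
    filter_upwards [hpair.eventually (eventually_eq_of_sub_mem_of_apply_eq hρ hC.disjoint.symm),
      hfst.eventually hρF, hfst.eventually hU] with q hq hqF hqU hqG
    rw [hq (by simp [G]) (hqG.trans hqF.symm)]
    exact hqU
  rw [mem_nhdsWithin_iff_eventually, ← hmap]
  exact hlevel

end LevelSet
section LieSpan

variable {R L : Type*} [CommRing R] [LieRing L] [LieAlgebra R L]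

theorem lieSpan_le_of_lie_mem {s : Set L} {V : Submodule R L} (hs : s ⊆ V)
    (hV : ∀ x ∈ s, ∀ v ∈ V, ⁅x, v⁆ ∈ V) : (LieSubalgebra.lieSpan R L s).toSubmodule ≤ V := by
  have hnormalizes : ∀ x ∈ LieSubalgebra.lieSpan R L s, ∀ v ∈ V, ⁅x, v⁆ ∈ V := by
    intro x hx
    induction hx using LieSubalgebra.lieSpan_induction with
    | mem x hx => exact hV x hx
    | zero => simp
    | add x y _ _ hx hy =>
      intro v hv
      rw [add_lie]
      exact V.add_mem (hx v hv) (hy v hv)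
    | smul r x _ hx =>
      intro v hv
      rw [smul_lie]
      exact V.smul_mem r (hx v hv)
    | lie x y _ _ hx hy =>
      intro v hv
      rw [lie_lie]
      exact V.sub_mem (hx _ (hy v hv)) (hy _ (hx v hv))
  intro x (hx : x ∈ LieSubalgebra.lieSpan R L s)
  induction hx using LieSubalgebra.lieSpan_induction with
  | mem x hx => exact hs hx
  | zero => exact V.zero_mem
  | add x y _ _ hx hy => exact V.add_mem hx hy
  | smul r x _ hx => exact V.smul_mem r hx
  | lie x y hx _ _ hy => exact hnormalizes x hx y hy

end LieSpan

section FlowMonoid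

variable {𝔸 : Type*} [NormedRing 𝔸] [NormedAlgebra ℝ 𝔸]

/-- The monoid of endpoints of the concatenations of the flows of the right-invariant fields
`X ↦ Z * X`, `Z ∈ 𝒵`, each followed forward in time. -/
def flowMonoid (𝒵 : Set 𝔸) : Submonoid 𝔸 :=
  Submonoid.closure {X | ∃ Z ∈ 𝒵, ∃ t : ℝ, 0 ≤ t ∧ X = NormedSpace.exp (t • Z)}

theorem exp_smul_mem_flowMonoid {𝒵 : Set 𝔸} {Z : 𝔸} (hZ : Z ∈ 𝒵) {t : ℝ} (ht : 0 ≤ t) :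
    NormedSpace.exp (t • Z) ∈ flowMonoid 𝒵 :=
  Submonoid.subset_closure ⟨Z, hZ, t, ht, rfl⟩

/-- `HasTangent S g T` says that some strictly differentiable family of elements of `S` passes
through `g` with velocities covering `T`. Velocities at `g` are recorded by their right translates
to the identity. -/
def HasTangent (S : Set 𝔸) (g : 𝔸ˣ) (T : Submodule ℝ 𝔸) : Prop :=
  ∃ (E : Type) (_ : NormedAddCommGroup E) (_ : NormedSpace ℝ E) (_ : CompleteSpace E)
    (F : E → 𝔸) (F' : E →L[ℝ] 𝔸),
    (∀ᶠ p in 𝓝 0, F p ∈ S) ∧ F 0 = g ∧ HasStrictFDerivAt F F' 0 ∧ ∀ v ∈ T, ∃ p, F' p = v * g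

theorem HasTangent.mem {S : Set 𝔸} {g : 𝔸ˣ} {T : Submodule ℝ 𝔸} (h : HasTangent S g T) :
    (g : 𝔸) ∈ S := by
  obtain ⟨E, _, _, _, F, F', hS, hF0, -⟩ := h
  exact hF0 ▸ hS.self_of_nhds

theorem hasTangent_bot {S : Set 𝔸} {g : 𝔸ˣ} (hg : (g : 𝔸) ∈ S) : HasTangent S g ⊥ := by
  refine ⟨ℝ, inferInstance, inferInstance, inferInstance, fun _ => g, 0,
    Eventually.of_forall fun _ => hg, rfl, hasStrictFDerivAt_const _ _, fun v hv => ⟨0, ?_⟩⟩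
  rw [(Submodule.mem_bot ℝ).1 hv, zero_mul, map_zero]

/-- The span of the conjugates of the fields in `𝒵` by the elements of their flow monoid. -/
noncomputable def conjSpan (𝒵 : Set 𝔸) : Submodule ℝ 𝔸 :=
  Submodule.span ℝ {X | ∃ h : 𝔸ˣ, (h : 𝔸) ∈ flowMonoid 𝒵 ∧ ∃ Z ∈ 𝒵, X = h * Z * ↑h⁻¹}

theorem subset_conjSpan (𝒵 : Set 𝔸) : 𝒵 ⊆ conjSpan 𝒵 := fun Z hZ =>
  Submodule.subset_span ⟨1, one_mem (flowMonoid 𝒵), Z, hZ, by simp⟩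

theorem conj_mem_of_mem_conjSpan {𝒵 : Set 𝔸} {g : 𝔸ˣ} {T : Submodule ℝ 𝔸}
    (hg : ∀ h : 𝔸ˣ, (h : 𝔸) ∈ flowMonoid 𝒵 → ∀ Z ∈ 𝒵, ↑(g * h) * Z * ↑(g * h)⁻¹ ∈ T) {v : 𝔸}
    (hv : v ∈ conjSpan 𝒵) : g * v * ↑g⁻¹ ∈ T := by
  induction hv using Submodule.span_induction with
  | mem x hx =>
    obtain ⟨h, hh, Z, hZ, rfl⟩ := hx
    simpa [mul_assoc] using hg h hh Z hZ
  | zero => simp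
  | add x y _ _ hx hy =>
    rw [mul_add, add_mul]
    exact T.add_mem hx hy
  | smul r x _ hx =>
    rw [mul_smul_comm, smul_mul_assoc]
    exact T.smul_mem r hx

variable [CompleteSpace 𝔸]

theorem hasStrictDerivAt_exp_one_add_smul (Z : 𝔸) :
    HasStrictDerivAt (fun t : ℝ => NormedSpace.exp ((1 + t) • Z)) (Z * NormedSpace.exp Z) 0 := by
  simpa using! (hasStrictDerivAt_exp_smul_const' (𝕂 := ℝ) Z (1 + 0)).scomp (0 : ℝ)
    ((hasStrictDerivAt_id (0 : ℝ)).const_add 1)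

theorem HasTangent.mul_exp {𝒵 : Set 𝔸} {g h u : 𝔸ˣ} {T : Submodule ℝ 𝔸}
    (hT : HasTangent (flowMonoid 𝒵 : Set 𝔸) g T) (hh : (h : 𝔸) ∈ flowMonoid 𝒵) {Z : 𝔸}
    (hZ : Z ∈ 𝒵) (hu : (u : 𝔸) = NormedSpace.exp Z) :
    HasTangent (flowMonoid 𝒵 : Set 𝔸) (g * (h * u))
      (T ⊔ Submodule.span ℝ {↑(g * h) * Z * ↑(g * h)⁻¹}) := by
  obtain ⟨E, _, _, _, F, F', hS, hF0, hF, hF'⟩ := hT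
  have hexp : HasStrictFDerivAt (fun q : E × ℝ => NormedSpace.exp ((1 + q.2) • Z)) _ 0 :=
    HasStrictFDerivAt.comp (0 : E × ℝ) (g := fun t : ℝ => NormedSpace.exp ((1 + t) • Z))
      (f := Prod.snd) (hasStrictDerivAt_exp_one_add_smul Z).hasStrictFDerivAt
      hasStrictFDerivAt_snd
  have hfst : HasStrictFDerivAt (fun q : E × ℝ => F q.1) _ 0 :=
    HasStrictFDerivAt.comp (0 : E × ℝ) (g := F) (f := Prod.fst) hF hasStrictFDerivAt_fst
  refine ⟨E × ℝ, inferInstance, inferInstance, inferInstance, _, _, ?_, ?_,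
    hfst.mul' (hexp.const_mul (h : 𝔸)), ?_⟩
  · filter_upwards [(continuous_fst.tendsto (0 : E × ℝ)).eventually hS,
      (continuous_snd.tendsto (0 : E × ℝ)).eventually (lt_mem_nhds (neg_one_lt_zero (R := ℝ)))]
      with q hFq hq
    exact mul_mem hFq (mul_mem hh (exp_smul_mem_flowMonoid hZ (by linarith)))
  · simp [hF0, hu]
  · intro v hv
    obtain ⟨w, hw, _, hr, rfl⟩ := Submodule.mem_sup.1 hv
    obtain ⟨r, rfl⟩ := Submodule.mem_span_singleton.1 hr
    obtain ⟨p, hp⟩ := hF' w hw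
    refine ⟨(p, r), ?_⟩
    have hcancel : ↑(g * h) * Z * ↑(g * h)⁻¹ * ↑(g * (h * u)) = (g : 𝔸) * h * (Z * u) := by
      simp [mul_assoc]
    rw [add_mul, smul_mul_assoc, hcancel]
    simp [hF0, hp, hu, mul_assoc, add_comm]

theorem exp_smul_conj_mem_conjSpan {𝒵 : Set 𝔸} {Z v : 𝔸} (hZ : Z ∈ 𝒵) (hv : v ∈ conjSpan 𝒵)
    {t : ℝ} (ht : 0 ≤ t) :
    NormedSpace.exp (t • Z) * v * NormedSpace.exp (t • -Z) ∈ conjSpan 𝒵 := by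
  let : NormedAlgebra ℚ 𝔸 := .restrictScalars ℚ ℝ 𝔸
  obtain ⟨k, hk⟩ := NormedSpace.isUnit_exp (t • Z)
  have hkinv : (↑k⁻¹ : 𝔸) = NormedSpace.exp (t • -Z) := by
    rw [smul_neg, ← Ring.inverse_exp, ← hk, Ring.inverse_unit]
  rw [← hk, ← hkinv]
  refine conj_mem_of_mem_conjSpan (fun h hh W hW => ?_) hv
  exact Submodule.subset_span
    ⟨k * h, mul_mem (hk ▸ exp_smul_mem_flowMonoid hZ ht) hh, W, hW, rfl⟩

end FlowMonoid

section FiniteDimensional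

variable {𝔸 : Type*} [NormedRing 𝔸] [NormedAlgebra ℝ 𝔸] [FiniteDimensional ℝ 𝔸]

theorem exists_hasTangent_forall_conj_mem (𝒵 : Set 𝔸) :
    ∃ g T, HasTangent (flowMonoid 𝒵 : Set 𝔸) g T ∧
      ∀ h : 𝔸ˣ, (h : 𝔸) ∈ flowMonoid 𝒵 → ∀ Z ∈ 𝒵, ↑(g * h) * Z * ↑(g * h)⁻¹ ∈ T := by
  have := FiniteDimensional.complete ℝ 𝔸
  let dims : Set ℕ :=
    {n | ∃ g T, HasTangent (flowMonoid 𝒵 : Set 𝔸) g T ∧ finrank ℝ T = n}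
  have hne : dims.Nonempty := ⟨_, 1, ⊥, hasTangent_bot (one_mem (flowMonoid 𝒵)), rfl⟩
  have hbdd : BddAbove dims := by
    refine ⟨finrank ℝ 𝔸, ?_⟩
    rintro _ ⟨g, T, -, rfl⟩
    exact T.finrank_le
  obtain ⟨g, T, hT, hmax⟩ := Nat.sSup_mem hne hbdd
  refine ⟨g, T, hT, fun h hh Z hZ => ?_⟩
  let : NormedAlgebra ℚ 𝔸 := .restrictScalars ℚ ℝ 𝔸
  obtain ⟨u, hu⟩ := NormedSpace.isUnit_exp Z
  have hle := le_csSup hbdd ⟨_, _, hT.mul_exp hh hZ hu, rfl⟩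
  rw [Submodule.eq_of_le_of_finrank_le le_sup_left (hle.trans_eq hmax.symm)]
  exact Submodule.mem_sup_right (Submodule.mem_span_singleton_self _)

attribute [local instance] LieRing.ofAssociativeRing

theorem lie_mem_conjSpan {𝒵 : Set 𝔸} {Z v : 𝔸} (hZ : Z ∈ 𝒵) (hv : v ∈ conjSpan 𝒵) :
    ⁅Z, v⁆ ∈ conjSpan 𝒵 := by
  have := FiniteDimensional.complete ℝ 𝔸
  have hderiv : HasDerivAt (fun t : ℝ => NormedSpace.exp (t • Z) * v * NormedSpace.exp (t • -Z))
      ⁅Z, v⁆ 0 := by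
    convert! ((hasDerivAt_exp_smul_const' (𝕂 := ℝ) Z 0).mul_const v).mul
      (hasDerivAt_exp_smul_const' (𝕂 := ℝ) (-Z) 0) using 1
    simp [Ring.lie_def, sub_eq_add_neg]
  have hslope := hderiv.tendsto_slope.mono_left
    (nhdsWithin_mono (0 : ℝ) fun t (ht : t ∈ Set.Ioi 0) => ne_of_gt ht)
  refine (conjSpan 𝒵).closed_of_finiteDimensional.mem_of_tendsto hslope ?_
  filter_upwards [self_mem_nhdsWithin] with t ht
  rw [slope_def_module]
  exact Submodule.smul_mem _ _ (Submodule.sub_mem _ (exp_smul_conj_mem_conjSpan hZ hv (le_of_lt ht))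
    (by simpa using hv))

theorem exists_hasTangent_forall_lieSpan_conj_mem (𝒵 : Set 𝔸) :
    ∃ g T, HasTangent (flowMonoid 𝒵 : Set 𝔸) g T ∧
      ∀ X ∈ LieSubalgebra.lieSpan ℝ 𝔸 𝒵, g * X * ↑g⁻¹ ∈ T := by
  obtain ⟨g, T, hT, hg⟩ := exists_hasTangent_forall_conj_mem 𝒵
  exact ⟨g, T, hT, fun X hX => conj_mem_of_mem_conjSpan hg <|
    lieSpan_le_of_lie_mem (subset_conjSpan 𝒵) (fun Z hZ v hv => lie_mem_conjSpan hZ hv) hX⟩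

end FiniteDimensional

open scoped Matrix.Norms.L2Operator

open Matrix

section Determinant

variable {n 𝕜 : Type*} [Fintype n] [DecidableEq n] [RCLike 𝕜]

theorem contDiff_det {m : WithTop ℕ∞} : ContDiff 𝕜 m (det : Matrix n n 𝕜 → 𝕜) := by
  have hentry : ∀ i j, ContDiff 𝕜 m fun M : Matrix n n 𝕜 => M i j := fun i j =>
    (entryLinearMap 𝕜 𝕜 i j).toContinuousLinearMap.contDiff
  rw [show (det : Matrix n n 𝕜 → 𝕜) = _ from funext det_apply]
  exact ContDiff.sum fun σ _ => (contDiff_prod fun i _ => hentry (σ i) i).const_smul _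

theorem hasStrictFDerivAt_det_one :
    HasStrictFDerivAt (det : Matrix n n 𝕜 → 𝕜) (traceLinearMap n 𝕜 𝕜).toContinuousLinearMap 1 := by
  have hdet := contDiff_det.contDiffAt.hasStrictFDerivAt (x := (1 : Matrix n n 𝕜)) one_ne_zero
  convert! hdet using 1
  ext M
  have hline : HasDerivAt (fun r : 𝕜 => 1 + r • M) M 0 := by
    simpa using ((hasDerivAt_id (0 : 𝕜)).smul_const M).const_add 1
  have hcomp : HasDerivAt (fun r : 𝕜 => det (1 + r • M)) (fderiv 𝕜 det 1 M) 0 :=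
    hdet.hasFDerivAt.comp_hasDerivAt_of_eq 0 hline (by simp)
  have htaylor : HasDerivAt (fun r : 𝕜 => det (1 + r • M)) M.trace 0 := by
    rw [← derivative_det_one_add_X_smul]
    convert! Polynomial.hasDerivAt (det (1 + (Polynomial.X : Polynomial 𝕜) • M.map Polynomial.C)) 0
      using 1
    ext r
    simp [eval_det, smul_eq_mul_diagonal]
  exact htaylor.unique hcomp

theorem hasDerivAt_det_exp_smul (Z : Matrix n n 𝕜) (t : 𝕜) :
    HasDerivAt (fun s : 𝕜 => det (NormedSpace.exp (s • Z)))
      (Z.trace * det (NormedSpace.exp (t • Z))) t := by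
  have hsplit : ∀ s : 𝕜, det (NormedSpace.exp (s • Z)) =
      det (NormedSpace.exp ((s - t) • Z)) * det (NormedSpace.exp (t • Z)) := fun s => by
    rw [← det_mul, ← Matrix.exp_add_of_commute _ _ (((Commute.refl Z).smul_left _).smul_right _),
      ← add_smul, sub_add_cancel]
  have hexp : HasDerivAt (fun s : 𝕜 => NormedSpace.exp ((s - t) • Z)) Z t := by
    simpa using! (hasDerivAt_exp_smul_const' (𝕂 := 𝕜) Z (t - t)).comp_sub_const t t
  rw [show (fun s : 𝕜 => det (NormedSpace.exp (s • Z))) = _ from funext hsplit]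
  exact (hasStrictFDerivAt_det_one.hasFDerivAt.comp_hasDerivAt_of_eq t hexp (by simp)).mul_const _

theorem det_exp (Z : Matrix n n 𝕜) : det (NormedSpace.exp Z) = NormedSpace.exp Z.trace := by
  let f : 𝕜 → 𝕜 := fun t => det (NormedSpace.exp (t • Z)) * NormedSpace.exp (t • -Z.trace)
  have hf : ∀ t, HasDerivAt f 0 t := fun t =>
    ((hasDerivAt_det_exp_smul Z t).mul
      (hasDerivAt_exp_smul_const' (𝕂 := 𝕜) (-Z.trace) t)).congr_deriv (by ring)
  have hconst : f 1 = f 0 := is_const_of_deriv_eq_zero (fun t => (hf t).differentiableAt)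
    (fun t => (hf t).deriv) 1 0
  let : NormedAlgebra ℚ 𝕜 := .restrictScalars ℚ 𝕜 𝕜
  have hinv : det (NormedSpace.exp Z) * (NormedSpace.exp Z.trace)⁻¹ = 1 := by
    simpa [f, NormedSpace.exp_neg] using hconst
  exact (mul_inv_eq_one₀ (NormedSpace.isUnit_exp _).ne_zero).1 hinv

end Determinant

section SpecialUnitaryGroup

variable {n : Type*} [Fintype n] [DecidableEq n]

instance : IsTopologicalGroup (specialUnitaryGroup n ℂ) where
  continuous_inv := (continuous_star.comp continuous_subtype_val).subtype_mk _

theorem isClosed_specialUnitaryGroup :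
    IsClosed (specialUnitaryGroup n ℂ : Set (Matrix n n ℂ)) := by
  have hunitary : IsClosed (unitaryGroup n ℂ : Set (Matrix n n ℂ)) := isClosed_unitary
  exact hunitary.inter (isClosed_eq (f := det) continuous_id.matrix_det continuous_const)

instance : CompactSpace (specialUnitaryGroup n ℂ) := by
  have : ProperSpace (Matrix n n ℂ) := FiniteDimensional.proper ℂ _
  refine isCompact_iff_compactSpace.1
    (Metric.isCompact_of_isClosed_isBounded isClosed_specialUnitaryGroup ?_)
  refine (Metric.isBounded_closedBall (x := (0 : Matrix n n ℂ)) (r := 1)).subset fun X hX => ?_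
  rw [mem_closedBall_zero_iff]
  cases subsingleton_or_nontrivial (Matrix n n ℂ) with
  | inl h => simp [Subsingleton.elim X 0]
  | inr h => exact (CStarRing.norm_of_mem_unitary (specialUnitaryGroup_le_unitaryGroup hX)).le

theorem exists_circle_notMem {s : Set ℂ} (hs : s.Finite) : ∃ c : Circle, (c : ℂ) ∉ s := by
  have hne : (1 : Circle) ≠ -1 := fun h => by
    have hcoe := congrArg (fun c : Circle => (c : ℂ)) h
    norm_num at hcoe
  have : Nontrivial Circle := ⟨1, -1, hne⟩
  have : Infinite Circle := PreconnectedSpace.infinite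
  by_contra! h
  exact Set.infinite_range_of_injective (α := Circle) Circle.coe_injective
    (hs.subset (Set.range_subset_iff.2 h))

theorem joined_one_unitary (u : unitary (Matrix n n ℂ)) : Joined 1 u := by
  -- Rotate the spectrum of `u` away from `-1`.
  obtain ⟨c, hc⟩ := exists_circle_notMem (Matrix.finite_spectrum (-(u : Matrix n n ℂ)))
  have hsmul (d : Circle) : (d : ℂ) • (u : Matrix n n ℂ) ∈ unitary (Matrix n n ℂ) :=
    Unitary.smul_mem_of_mem
      (Unitary.mem_iff_self_mul_star.2 (by simpa using Complex.mul_conj (d : ℂ))) u.2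
  let rotate : Circle → unitary (Matrix n n ℂ) := fun d => ⟨(d : ℂ) • u, hsmul d⟩
  have hrotate : Continuous rotate := (by fun_prop : Continuous fun d : Circle =>
    (d : ℂ) • (u : Matrix n n ℂ)).subtype_mk _
  have hspec : -1 ∉ spectrum ℂ (rotate c⁻¹ : Matrix n n ℂ) := fun h => by
    have hmul := (spectrum.smul_mem_smul_iff (r := Units.mk0 (c : ℂ) c.coe_ne_zero)).2 h
    refine hc ?_
    simpa [rotate, Units.smul_def, smul_smul, ← spectrum.neg_eq] using hmul
  refine (Unitary.joined 1 (rotate c⁻¹) ?_).trans ?_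
  · rwa [OneMemClass.coe_one, Unitary.norm_sub_one_lt_two_iff (hsmul c⁻¹)]
  · convert (PathConnectedSpace.joined c⁻¹ 1).map hrotate
    ext1
    simp [rotate]

theorem mul_diagonal_update_mem_specialUnitaryGroup {U : Matrix n n ℂ} (hU : U ∈ unitaryGroup n ℂ)
    (i : n) : U * diagonal (Function.update 1 i (star U.det)) ∈ specialUnitaryGroup n ℂ := by
  have hdet : U.det * star U.det = 1 := Unitary.mem_iff_self_mul_star.1 (det_of_mem_unitary hU)
  refine mem_specialUnitaryGroup_iff.2 ⟨mul_mem hU ?_, ?_⟩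
  · rw [mem_unitaryGroup_iff, star_eq_conjTranspose, diagonal_conjTranspose, diagonal_mul_diagonal,
      ← diagonal_one]
    congr 1
    ext j
    obtain rfl | hj := eq_or_ne j i
    · simpa [mul_comm] using hdet
    · simp [hj]
  · rw [det_mul, det_diagonal, Finset.prod_update_of_mem (Finset.mem_univ _)]
    simpa using hdet

instance : ConnectedSpace (specialUnitaryGroup n ℂ) := by
  obtain _ | ⟨⟨i⟩⟩ := isEmpty_or_nonempty n
  · exact inferInstance
  · have : PathConnectedSpace (unitary (Matrix n n ℂ)) :=
      ⟨⟨1⟩, fun u v => (joined_one_unitary u).symm.trans (joined_one_unitary v)⟩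
    let normalize : unitary (Matrix n n ℂ) → specialUnitaryGroup n ℂ := fun u =>
      ⟨_, mul_diagonal_update_mem_specialUnitaryGroup u.2 i⟩
    have hcont : Continuous normalize := by
      refine (continuous_subtype_val.mul ?_).subtype_mk _
      refine (continuous_const.update i ?_).matrix_diagonal
      exact continuous_star.comp continuous_subtype_val.matrix_det
    have hsurj : Function.Surjective normalize := fun g => by
      refine ⟨⟨g, specialUnitaryGroup_le_unitaryGroup g.2⟩, Subtype.ext ?_⟩
      simp [normalize, (mem_specialUnitaryGroup_iff.1 g.2).2]
    exact hsurj.connectedSpace hcont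

theorem exp_mem_specialUnitaryGroup {Z : Matrix n n ℂ} (hZ : star Z = -Z) (htr : Z.trace = 0) :
    NormedSpace.exp Z ∈ specialUnitaryGroup n ℂ := by
  let : NormedAlgebra ℚ (Matrix n n ℂ) := .restrictScalars ℚ ℂ _
  refine mem_specialUnitaryGroup_iff.2
    ⟨NormedSpace.exp_mem_unitary_of_mem_skewAdjoint (skewAdjoint.mem_iff.2 hZ), ?_⟩
  rw [det_exp, htr, NormedSpace.exp_zero]

theorem hasStrictFDerivAt_mul_star_self_prodMk_det_one :
    HasStrictFDerivAt (fun X : Matrix n n ℂ => (X * star X, X.det))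
      ((ContinuousLinearMap.id ℝ (Matrix n n ℂ) + (starL' ℝ : _ ≃L[ℝ] Matrix n n ℂ)).prod
        ((traceLinearMap n ℂ ℂ).toContinuousLinearMap.restrictScalars ℝ)) 1 := by
  have hstar : HasStrictFDerivAt (star : Matrix n n ℂ → Matrix n n ℂ)
      ((starL' ℝ : _ ≃L[ℝ] Matrix n n ℂ) : Matrix n n ℂ →L[ℝ] Matrix n n ℂ) 1 :=
    (starL' ℝ : _ ≃L[ℝ] Matrix n n ℂ).hasStrictFDerivAt
  refine (((hasStrictFDerivAt_id 1).mul' hstar).congr_fderiv ?_).prodMk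
    (hasStrictFDerivAt_det_one.restrictScalars ℝ)
  ext1 v
  simp [add_comm]

theorem HasTangent.eventually_mul_mem {S : Set (Matrix n n ℂ)} {g : (Matrix n n ℂ)ˣ}
    {T : Submodule ℝ (Matrix n n ℂ)} (hT : HasTangent S g T)
    (hS : S ⊆ specialUnitaryGroup n ℂ)
    (hsu : ∀ v : Matrix n n ℂ, star v = -v → v.trace = 0 → v ∈ T) :
    ∀ᶠ X : Matrix n n ℂ in 𝓝[specialUnitaryGroup n ℂ] 1, X * g ∈ S := by
  let G : specialUnitaryGroup n ℂ := ⟨g, hS hT.mem⟩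
  have hstar_mem : star (g : Matrix n n ℂ) ∈ specialUnitaryGroup n ℂ := (star G).2
  have hstar_mul : star (g : Matrix n n ℂ) * g = 1 := Unitary.star_mul_self_of_mem G.2.1
  have hmul_star : (g : Matrix n n ℂ) * star (g : Matrix n n ℂ) = 1 :=
    Unitary.mul_star_self_of_mem G.2.1
  obtain ⟨E, _, _, _, F, F', hFS, hF0, hF, hF'⟩ := hT
  let ρ : Matrix n n ℂ → Matrix n n ℂ × ℂ := fun X => (X * star X, X.det)
  have hlevel : ρ ⁻¹' {(1, 1)} = specialUnitaryGroup n ℂ := by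
    ext X
    simp [ρ, mem_specialUnitaryGroup_iff, mem_unitaryGroup_iff]
  have hF0_mul : F 0 * star (g : Matrix n n ℂ) = 1 := by rw [hF0, hmul_star]
  have hρ1 : ρ 1 = (1, 1) := hlevel.ge (one_mem (specialUnitaryGroup n ℂ))
  have hcover := nhdsWithin_levelSet_le_map_nhds (hF.mul_const' (star (g : Matrix n n ℂ)))
    (ρ := ρ) (hF0_mul ▸ hasStrictFDerivAt_mul_star_self_prodMk_det_one) ?_ ?_
  · rw [hF0_mul, hρ1, hlevel] at hcover
    refine hcover (mem_map.2 ?_)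
    filter_upwards [hFS] with p hp
    simpa [mul_assoc, hstar_mul] using hp
  · filter_upwards [hFS] with p hp
    rw [hF0_mul, hρ1]
    exact hlevel.ge (mul_mem (hS hp) hstar_mem)
  · intro v hv
    obtain ⟨hskew, htr⟩ : v + star v = 0 ∧ v.trace = 0 := by simpa using hv
    obtain ⟨p, hp⟩ := hF' v (hsu v (eq_neg_of_add_eq_zero_right hskew) htr)
    exact ⟨p, by simp [hp, mul_assoc, hmul_star]⟩

end SpecialUnitaryGroup

section TwoLevel

variable {n R : Type*} [DecidableEq n]

/-- The skew-Hermitian matrix `z E_{jk} - star z E_{kj}`, which couples only the levels `j` and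
`k`. -/
def twoLevel [AddGroup R] [Star R] (j k : n) (z : R) : Matrix n n R :=
  single j k z - single k j (star z)

theorem sum_twoLevel [AddCommGroup R] [StarAddMonoid R] {ι : Type*} (s : Finset ι) (j k : n)
    (z : ι → R) : ∑ i ∈ s, twoLevel j k (z i) = twoLevel j k (∑ i ∈ s, z i) := by
  simp only [twoLevel, Finset.sum_sub_distrib, star_sum, ← singleAddMonoidHom_apply, map_sum]

theorem twoLevel_eq_of_apply_eq [AddGroup R] [StarAddMonoid R] {i j : n} (hij : i ≠ j)
    {M : Matrix n n R} (hji : M j i = -star (M i j))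
    (hzero : ∀ k l, ¬(k = i ∧ l = j) → ¬(k = j ∧ l = i) → M k l = 0) :
    twoLevel i j (M i j) = M := by
  ext k l
  by_cases hkl : k = i ∧ l = j
  · obtain ⟨rfl, rfl⟩ := hkl
    simp [twoLevel, hij, hij.symm]
  by_cases hlk : k = j ∧ l = i
  · obtain ⟨rfl, rfl⟩ := hlk
    simp [twoLevel, hij, hij.symm, hji]
  · rw [hzero k l hkl hlk, twoLevel, Matrix.sub_apply, single_apply_of_ne, single_apply_of_ne,
      sub_zero] <;> tauto

variable [Fintype n]

theorem sum_sum_twoLevel [AddCommGroup R] [StarAddMonoid R] (M : Matrix n n R) :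
    ∑ j, ∑ k, twoLevel j k (M j k) = M - Mᴴ := by
  simp only [twoLevel, Finset.sum_sub_distrib]
  rw [← matrix_eq_sum_single, Finset.sum_comm, matrix_eq_sum_single Mᴴ]
  rfl

attribute [local instance] LieRing.ofAssociativeRing

variable [CommRing R]

theorem lie_diagonal_apply (d : n → R) (M : Matrix n n R) (j k : n) :
    ⁅diagonal d, M⁆ j k = (d j - d k) * M j k := by
  rw [Ring.lie_def, Matrix.sub_apply, diagonal_mul, mul_diagonal]
  ring

variable {K : Type*} [CommRing K] [Algebra K R] {L : LieSubalgebra K (Matrix n n R)}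

theorem of_aeval_sub_mul_mem {d : n → R} (hd : diagonal d ∈ L) {M : Matrix n n R} (hM : M ∈ L)
    (p : Polynomial K) : (of fun j k => Polynomial.aeval (d j - d k) p * M j k) ∈ L := by
  induction p using Polynomial.induction_on with
  | C a =>
    convert! L.smul_mem a hM using 1
    ext j k
    simp [Algebra.smul_def]
  | add p q hp hq =>
    convert! L.add_mem hp hq using 1
    ext j k
    simp [add_mul]
  | monomial m a hm =>
    convert! L.lie_mem hd hm using 1
    ext j k
    rw [lie_diagonal_apply]
    simp [pow_succ]
    ring

variable [StarRing R]

theorem lie_twoLevel_twoLevel {j k l : n} (hjk : j ≠ k) (hkl : k ≠ l) (hjl : j ≠ l) (z w : R) :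
    ⁅twoLevel j k z, twoLevel k l w⁆ = twoLevel j l (z * w) := by
  simp [Ring.lie_def, twoLevel, sub_mul, mul_sub, single_mul_single_of_ne, hjk, hkl, hjl,
    hjk.symm, hkl.symm, hjl.symm, mul_comm]

theorem lie_twoLevel_one_twoLevel {j k : n} (hjk : j ≠ k) (z : R) :
    ⁅(twoLevel j k 1 : Matrix n n R), twoLevel j k z⁆ = twoLevel j j z - twoLevel k k z := by
  simp [Ring.lie_def, twoLevel, sub_mul, mul_sub, single_mul_single_of_ne, hjk, hjk.symm]
  abel

theorem twoLevel_mem_of_reachable {G : SimpleGraph n}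
    (hG : ∀ j k, G.Adj j k → ∀ z, twoLevel j k z ∈ L) {j k : n} (hjk : G.Reachable j k)
    (hne : j ≠ k) (z : R) : twoLevel j k z ∈ L := by
  obtain ⟨walk⟩ := hjk
  induction walk generalizing z with
  | nil => exact absurd rfl hne
  | @cons j i k hji _ ih =>
    obtain rfl | hik := eq_or_ne i k
    · exact hG j i hji z
    · rw [← mul_one z, ← lie_twoLevel_twoLevel hji.ne hik hne]
      exact L.lie_mem (hG j i hji z) (ih hik 1)

theorem twoLevel_self_sub_twoLevel_self_mem (hL : ∀ j k, j ≠ k → ∀ z, twoLevel j k z ∈ L)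
    (j k : n) (z : R) : twoLevel j j z - twoLevel k k z ∈ L := by
  obtain rfl | hjk := eq_or_ne j k
  · simp
  · rw [← lie_twoLevel_one_twoLevel hjk]
    exact L.lie_mem (hL j k hjk 1) (hL j k hjk z)

theorem mem_of_forall_twoLevel_mem [Invertible (2 : K)]
    (hL : ∀ j k, j ≠ k → ∀ z, twoLevel j k z ∈ L) {M : Matrix n n R} (hM : Mᴴ = -M)
    (htr : M.trace = 0) : M ∈ L := by
  suffices h : ∑ j, ∑ k, twoLevel j k (M j k) ∈ L by
    rw [sum_sum_twoLevel, hM, sub_neg_eq_add, ← two_smul K] at h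
    simpa using L.smul_mem (⅟2 : K) h
  obtain _ | ⟨⟨i⟩⟩ := isEmpty_or_nonempty n
  · simp
  have hdiag : ∑ j, ∑ k, (if j = k then twoLevel i i (M j j) else 0) = 0 := by
    simp only [Finset.sum_ite_eq, Finset.mem_univ, if_true, sum_twoLevel]
    rw [show ∑ j, M j j = 0 from htr]
    simp [twoLevel]
  rw [← sub_zero (∑ j, ∑ k, twoLevel j k (M j k)), ← hdiag]
  simp only [← Finset.sum_sub_distrib]
  refine L.toSubmodule.sum_mem fun j _ => L.toSubmodule.sum_mem fun k _ => ?_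
  split_ifs with hjk
  · obtain rfl := hjk
    exact twoLevel_self_sub_twoLevel_self_mem hL j i _
  · rw [sub_zero]
    exact hL j k hjk _

end TwoLevel

section SpectralFilter

open Polynomial in
theorem exists_aeval_mul_I_eq (s : Finset ℝ) {g : ℝ} (hg : g ≠ 0) (w : ℂ) :
    ∃ p : ℝ[X], aeval (Complex.I * g) p = w ∧
      ∀ x ∈ s, x ^ 2 ≠ g ^ 2 → aeval (Complex.I * x) p = 0 := by
  let q : ℝ[X] := ∏ x ∈ s with x ^ 2 ≠ g ^ 2, (X ^ 2 + C (x ^ 2))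
  have hq (y : ℝ) : aeval (Complex.I * y) q =
      ∏ x ∈ s with x ^ 2 ≠ g ^ 2, ((x : ℂ) ^ 2 - y ^ 2) := by
    simp only [q, map_prod]
    refine Finset.prod_congr rfl fun x _ => ?_
    simp [mul_pow]
    ring
  have hqg : aeval (Complex.I * g) q ≠ 0 := by
    rw [hq, Finset.prod_ne_zero_iff]
    intro x hx
    rw [sub_ne_zero]
    exact_mod_cast (Finset.mem_filter.1 hx).2
  let z : ℂ := w / aeval (Complex.I * g) q
  have hg' : (g : ℂ) ≠ 0 := by exact_mod_cast hg
  refine ⟨q * (C z.re + C (z.im / g) * X), ?_, fun x hx hxg => ?_⟩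
  · have hz : (z.re : ℂ) + z.im / g * (Complex.I * g) = z := by
      conv_rhs => rw [← Complex.re_add_im z]
      field_simp
    simp only [map_mul, map_add, aeval_C, aeval_X, Complex.coe_algebraMap, Complex.ofReal_div]
    rw [hz, mul_div_cancel₀ _ hqg]
  · rw [map_mul, hq, Finset.prod_eq_zero (Finset.mem_filter.2 ⟨hx, hxg⟩) (sub_self ((x : ℂ) ^ 2)),
      zero_mul]

variable {n : Type*} [Fintype n] [DecidableEq n]

attribute [local instance] LieRing.ofAssociativeRing

theorem twoLevel_mem_of_gap_unique {L : LieSubalgebra ℝ (Matrix n n ℂ)} {e : n → ℝ}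
    (he : diagonal (fun k => -Complex.I * (e k : ℂ)) ∈ L) {B : Matrix n n ℂ} (hB : B ∈ L)
    (hskew : Bᴴ = -B) {i j : n} (hij : B i j ≠ 0) (hgap : e j - e i ≠ 0)
    (hunique : ∀ k l, e l - e k = e j - e i → k = i ∧ l = j) (z : ℂ) : twoLevel i j z ∈ L := by
  obtain ⟨p, hp, hp0⟩ := exists_aeval_mul_I_eq
    (Finset.univ.image fun kl : n × n => e kl.2 - e kl.1) hgap (z / B i j)
  let M : Matrix n n ℂ := of fun k l => Polynomial.aeval (Complex.I * ↑(e l - e k)) p * B k l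
  have hM : M ∈ L := by
    have hd k l : -Complex.I * (e k : ℂ) - -Complex.I * (e l : ℂ) = Complex.I * ↑(e l - e k) := by
      push_cast
      ring
    simpa only [hd] using of_aeval_sub_mul_mem he hB p
  have hMij : M i j = z := by
    simp only [M, of_apply, hp, div_mul_cancel₀ _ hij]
  have hMji : M j i = -star (M i j) := by
    have hBji : B j i = -star (B i j) :=
      neg_eq_iff_eq_neg.1 (congrFun (congrFun hskew j) i).symm
    have hconj : Complex.I * ↑(e i - e j) = starRingEnd ℂ (Complex.I * ↑(e j - e i)) := by
      simp [← mul_neg]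
    simp only [M, of_apply, hconj, hBji, Polynomial.aeval_conj]
    simp
  rw [← hMij, twoLevel_eq_of_apply_eq (fun h => hgap (by simp [h])) hMji]
  · exact hM
  intro k l hkl hlk
  have hsq : (e l - e k) ^ 2 ≠ (e j - e i) ^ 2 := fun h => by
    obtain h | h := sq_eq_sq_iff_eq_or_eq_neg.1 h
    · exact hkl (hunique k l h)
    · exact hlk (hunique l k (by linarith)).symm
  simp only [M, of_apply]
  rw [hp0 _ (Finset.mem_image_of_mem _ (Finset.mem_univ (k, l))) hsq, zero_mul]

end SpectralFilter

section Roots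

variable {N : ℕ}

theorem mem_realCartan {x : Fin N → ℝ} : x ∈ realCartan N ↔ ∑ i, x i = 0 := by
  simp [realCartan]

theorem root_apply (i j : Fin N) (x : realCartan N) :
    root i j x = (x : Fin N → ℝ) i - (x : Fin N → ℝ) j := rfl

theorem root_eq_root_iff {i j k l : Fin N} (hij : i ≠ j) :
    root i j = root k l ↔ i = k ∧ j = l := by
  refine ⟨fun h => ?_, by rintro ⟨rfl, rfl⟩; rfl⟩
  have hx : (Pi.single i 1 - Pi.single j 1 : Fin N → ℝ) ∈ realCartan N := by
    simp [mem_realCartan]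
  have hval := LinearMap.congr_fun h ⟨_, hx⟩
  simp only [root_apply, Pi.sub_apply, Pi.single_apply] at hval
  grind

theorem exists_root_apply_eq_sub (N : ℕ) :
    ∃ x : realCartan N, ∀ i j : Fin N, root i j x = (j : ℝ) - i := by
  let mean : ℝ := (∑ k : Fin N, (k : ℝ)) / N
  have hx : (fun k : Fin N => mean - k) ∈ realCartan N := by
    obtain rfl | hN := eq_or_ne N 0
    · simp [mem_realCartan]
    · rw [mem_realCartan, Finset.sum_sub_distrib, Finset.sum_const, Finset.card_univ,
        Fintype.card_fin, nsmul_eq_mul, mul_div_cancel₀ _ (by exact_mod_cast hN), sub_self]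
  exact ⟨⟨_, hx⟩, fun i j => by simp [root_apply]⟩

theorem root_mem_fundamentalRoots {i j : Fin N} (hij : i ⋖ j) : root i j ∈ fundamentalRoots N := by
  -- Positive roots take values at least `1` at the dual Weyl vector, and `root i j` takes `1`.
  obtain ⟨x, hx⟩ := exists_root_apply_eq_sub N
  refine ⟨⟨i, j, hij.lt, rfl⟩, ?_⟩
  rintro _ ⟨a, b, hab, rfl⟩ _ ⟨c, d, hcd, rfl⟩ hsum
  have hval := LinearMap.congr_fun hsum x
  simp only [LinearMap.add_apply, hx] at hval
  have hij' : (j : ℝ) = i + 1 := by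
    exact_mod_cast (Nat.covBy_iff_add_one_eq.1 (Fin.covBy_iff.1 hij)).symm
  have hab' : (a : ℝ) + 1 ≤ b := by exact_mod_cast hab
  have hcd' : (c : ℝ) + 1 ≤ d := by exact_mod_cast hcd
  linarith

/-- The graph on the energy levels that joins `i < j` when the root `α_{ij}` is touched by `B` and
regular for `drift E`. -/
def touchedRegularGraph (E : realCartan N) (B : Matrix (Fin N) (Fin N) ℂ) :
    SimpleGraph (Fin N) :=
  SimpleGraph.fromRel fun i j => i < j ∧ root i j ∈ touchedRegularRoots E B

variable {E : realCartan N} {B : Matrix (Fin N) (Fin N) ℂ}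

theorem preconnected_touchedRegularGraph (hΦ : fundamentalRoots N ⊆ touchedRegularRoots E B) :
    (touchedRegularGraph E B).Preconnected := by
  refine (SimpleGraph.pathGraph_preconnected N).mono fun i j hij => ⟨hij.ne, ?_⟩
  exact hij.imp (fun h => ⟨h.lt, hΦ (root_mem_fundamentalRoots h)⟩)
    fun h => ⟨h.lt, hΦ (root_mem_fundamentalRoots h)⟩

theorem entry_ne_zero_of_root_mem_touchedRoots {i j : Fin N} (hij : i ≠ j)
    (h : root i j ∈ touchedRoots B) : B i j ≠ 0 := by
  obtain ⟨k, l, -, hB, hkl⟩ := h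
  obtain ⟨rfl, rfl⟩ := (root_eq_root_iff hij).1 hkl
  exact hB

theorem gap_ne_zero_and_unique_of_root_mem_regularPosRoots {i j : Fin N}
    (h : root i j ∈ regularPosRoots E) :
    E.1 j - E.1 i ≠ 0 ∧ ∀ k l, E.1 l - E.1 k = E.1 j - E.1 i → k = i ∧ l = j := by
  have hneg (k l : Fin N) : root k l (-E) = E.1 l - E.1 k := by
    rw [root_apply]
    simp
    ring
  obtain ⟨-, hne, hunique⟩ := h
  rw [hneg] at hne
  refine ⟨hne, fun k l hkl => ?_⟩
  have hkl' : k ≠ l := by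
    rintro rfl
    exact hne (by rw [← hkl, sub_self])
  refine (root_eq_root_iff hkl').1 ?_
  by_contra hroot
  exact hunique _ ⟨k, l, hkl', rfl⟩ hroot (by rw [hneg, hneg, hkl])

attribute [local instance] LieRing.ofAssociativeRing

variable {L : LieSubalgebra ℝ (Matrix (Fin N) (Fin N) ℂ)}

theorem twoLevel_mem_of_adj (hE : drift E ∈ L) (hB : B ∈ L) (hskew : Bᴴ = -B) {i j : Fin N}
    (hij : (touchedRegularGraph E B).Adj i j) (z : ℂ) : twoLevel i j z ∈ L := by
  have hmem {i j : Fin N} (hlt : i < j) (h : root i j ∈ touchedRegularRoots E B) (z : ℂ) :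
      twoLevel i j z ∈ L := by
    obtain ⟨hgap, hunique⟩ := gap_ne_zero_and_unique_of_root_mem_regularPosRoots h.2
    exact twoLevel_mem_of_gap_unique hE hB hskew
      (entry_ne_zero_of_root_mem_touchedRoots hlt.ne h.1) hgap hunique z
  obtain ⟨-, ⟨hlt, h⟩ | ⟨hlt, h⟩⟩ := hij
  · exact hmem hlt h z
  · have hswap : twoLevel i j z = -twoLevel j i (star z) := by simp [twoLevel]
    rw [hswap]
    exact L.neg_mem (hmem hlt h (star z))

theorem su_subset_of_preconnected (hE : drift E ∈ L) (hB : B ∈ L) (hskew : Bᴴ = -B)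
    (hconn : (touchedRegularGraph E B).Preconnected) : su N ⊆ L := fun _ hM =>
  mem_of_forall_twoLevel_mem (fun i j hij => twoLevel_mem_of_reachable
    (fun _ _ => twoLevel_mem_of_adj hE hB hskew) (hconn i j) hij) hM.1 hM.2

end Roots

section Reachability

variable {N : ℕ}

theorem add_smul_mem_su {A B : Matrix (Fin N) (Fin N) ℂ} (hA : A ∈ su N) (hB : B ∈ su N) (c : ℝ) :
    A + (c : ℂ) • B ∈ su N := by
  refine ⟨?_, ?_⟩
  · rw [conjTranspose_add, conjTranspose_smul, hA.1, hB.1]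
    simp [add_comm]
  · rw [trace_add, trace_smul, hA.2, hB.2, smul_zero, add_zero]

theorem smul_mem_su {Z : Matrix (Fin N) (Fin N) ℂ} (hZ : Z ∈ su N) (t : ℝ) : t • Z ∈ su N := by
  refine ⟨?_, ?_⟩
  · rw [conjTranspose_smul, hZ.1, star_trivial, smul_neg]
  · rw [trace_smul, hZ.2, smul_zero]

theorem drift_mem_su (E : realCartan N) : drift E ∈ su N := by
  refine ⟨?_, ?_⟩
  · rw [drift, diagonal_conjTranspose, diagonal_neg]
    congr 1
    ext k
    simp
  · rw [drift, trace_diagonal, ← Finset.mul_sum, ← Complex.ofReal_sum, mem_realCartan.1 E.2,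
      Complex.ofReal_zero, mul_zero]

theorem IsPiecewiseConstant.ite_le_const {u : ℝ → ℝ} {T : ℝ} (hu : IsPiecewiseConstant u T)
    (T' c : ℝ) : IsPiecewiseConstant (fun s => if s ≤ T then u s else c) T' := by
  obtain ⟨F, hF⟩ := hu
  refine ⟨insert T F, fun s t hs hst _ hr => ?_⟩
  by_cases htT : t ≤ T
  · simp only [if_pos htT, if_pos (hst.trans htT)]
    exact hF s t hs hst htT fun r hrF => hr r (Finset.mem_insert_of_mem hrF)
  · have hsT : ¬s ≤ T := fun h => hr T (Finset.mem_insert_self _ _) ⟨h, (not_le.1 htT).le⟩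
    simp only [if_neg htT, if_neg hsT]

/-- The one-parameter subgroup `t ↦ exp (t • Z)` of `SU(N)` generated by `Z ∈ su N`. -/
noncomputable def expCurve {Z : Matrix (Fin N) (Fin N) ℂ} (hZ : Z ∈ su N) (t : ℝ) :
    specialUnitaryGroup (Fin N) ℂ :=
  ⟨NormedSpace.exp (t • Z),
    exp_mem_specialUnitaryGroup (smul_mem_su hZ t).1 (smul_mem_su hZ t).2⟩

theorem expCurve_zero {Z : Matrix (Fin N) (Fin N) ℂ} (hZ : Z ∈ su N) : expCurve hZ 0 = 1 :=
  Subtype.ext (by simp [expCurve])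

theorem continuous_expCurve {Z : Matrix (Fin N) (Fin N) ℂ} (hZ : Z ∈ su N) :
    Continuous (expCurve hZ) :=
  (continuous_iff_continuousAt.2 fun t =>
    (hasDerivAt_exp_smul_const (𝕂 := ℝ) Z t).continuousAt).subtype_mk _

theorem hasDerivAt_expCurve_mul_apply {Z : Matrix (Fin N) (Fin N) ℂ} (hZ : Z ∈ su N)
    (Y : specialUnitaryGroup (Fin N) ℂ) (T t : ℝ) (i j : Fin N) :
    HasDerivAt (fun s => (expCurve hZ (s - T) * Y : Matrix (Fin N) (Fin N) ℂ) i j)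
      ((Z * (expCurve hZ (t - T) * Y : Matrix (Fin N) (Fin N) ℂ)) i j) t := by
  have hexp := ((hasDerivAt_exp_smul_const' (𝕂 := ℝ) Z (t - T)).comp_sub_const t T).mul_const
    (Y : Matrix (Fin N) (Fin N) ℂ)
  rw [mul_assoc] at hexp
  exact ((entryLinearMap ℝ ℂ i j).toContinuousLinearMap.hasFDerivAt).comp_hasDerivAt t hexp

theorem one_mem_reachableSet (A B : Matrix (Fin N) (Fin N) ℂ) : 1 ∈ reachableSet A B := by
  refine ⟨0, le_rfl, 0, ⟨∅, fun _ _ _ _ _ _ => rfl⟩, 1, ⟨rfl, continuousOn_const, ∅, ?_⟩, rfl⟩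
  simp

theorem IsTrajectory.ite_le_expCurve_mul {A B : Matrix (Fin N) (Fin N) ℂ} {u : ℝ → ℝ} {T : ℝ}
    {X : ℝ → specialUnitaryGroup (Fin N) ℂ} (hX : IsTrajectory A B u T X) (hT : 0 ≤ T) {c : ℝ}
    (hZ : A + (c : ℂ) • B ∈ su N) {τ : ℝ} (hτ : 0 ≤ τ) :
    IsTrajectory A B (fun s => if s ≤ T then u s else c) (T + τ)
      (fun s => if s ≤ T then X s else expCurve hZ (s - T) * X T) := by
  obtain ⟨hX0, hXc, F, hF⟩ := hX
  refine ⟨by simp [hT, hX0], ?_, insert T F, fun t ht htF i j => ?_⟩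
  · have hglue : Continuous fun s => expCurve hZ (s - T) * X T :=
      ((continuous_expCurve hZ).comp (continuous_sub_right T)).mul continuous_const
    rw [← Set.Icc_union_Icc_eq_Icc hT (le_add_of_nonneg_right hτ)]
    refine ContinuousOn.union_of_isClosed (hXc.congr fun s hs => if_pos hs.2)
      (hglue.continuousOn.congr fun s hs => ?_) isClosed_Icc isClosed_Icc
    obtain rfl | hlt := hs.1.eq_or_lt
    · simp [expCurve_zero]
    · exact if_neg hlt.not_ge
  · rw [Finset.mem_insert, not_or] at htF
    obtain hlt | hgt := lt_or_gt_of_ne htF.1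
    · simp only [if_pos hlt.le]
      refine (hF t ⟨ht.1, hlt⟩ htF.2 i j).congr_of_eventuallyEq ?_
      filter_upwards [Iio_mem_nhds hlt] with s hs
      rw [if_pos (le_of_lt hs)]
    · simp only [if_neg hgt.not_ge]
      refine (hasDerivAt_expCurve_mul_apply hZ (X T) T t i j).congr_of_eventuallyEq ?_
      filter_upwards [Ioi_mem_nhds hgt] with s hs
      rw [if_neg (not_le_of_gt hs)]
      rfl

theorem expCurve_mul_mem_reachableSet {A B : Matrix (Fin N) (Fin N) ℂ} {c : ℝ}
    (hZ : A + (c : ℂ) • B ∈ su N) {Y : specialUnitaryGroup (Fin N) ℂ} (hY : Y ∈ reachableSet A B)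
    {τ : ℝ} (hτ : 0 ≤ τ) : expCurve hZ τ * Y ∈ reachableSet A B := by
  obtain ⟨T, hT, u, hu, X, hX, rfl⟩ := hY
  refine ⟨T + τ, by positivity, _, hu.ite_le_const (T + τ) c, _, hX.ite_le_expCurve_mul hT hZ hτ,
    ?_⟩
  obtain rfl | hpos := hτ.eq_or_lt
  · simp [expCurve_zero]
  · rw [if_neg (by linarith), add_sub_cancel_left]

theorem flowMonoid_subset_coe_image_reachableSet {A B : Matrix (Fin N) (Fin N) ℂ} (hA : A ∈ su N)
    (hB : B ∈ su N) :
    (flowMonoid (Set.range fun c : ℝ => A + (c : ℂ) • B) : Set (Matrix (Fin N) (Fin N) ℂ)) ⊆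
      (↑) '' reachableSet A B := by
  intro X hX
  induction hX using Submonoid.closure_induction_left with
  | one => exact ⟨1, one_mem_reachableSet A B, rfl⟩
  | mul_left _ hflow _ _ ih =>
    obtain ⟨_, ⟨c, rfl⟩, t, ht, rfl⟩ := hflow
    obtain ⟨Y, hY, rfl⟩ := ih
    exact ⟨_, expCurve_mul_mem_reachableSet (add_smul_mem_su hA hB c) hY ht, rfl⟩

end Reachability

section Controllability

variable {N : ℕ}

theorem controllable_of_flowMonoid_mem_nhds {A B : Matrix (Fin N) (Fin N) ℂ} (hA : A ∈ su N)
    (hB : B ∈ su N) {g : specialUnitaryGroup (Fin N) ℂ}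
    (hg : ∀ᶠ X : specialUnitaryGroup (Fin N) ℂ in 𝓝 g,
      (X : Matrix (Fin N) (Fin N) ℂ) ∈ flowMonoid (Set.range fun c : ℝ => A + (c : ℂ) • B)) :
    Controllable A B := by
  let S := (flowMonoid (Set.range fun c : ℝ => A + (c : ℂ) • B)).comap
    (specialUnitaryGroup (Fin N) ℂ).subtype
  have htop : S = ⊤ := submonoid_eq_top_of_mem_nhds (g := g) hg
  refine Set.eq_univ_of_forall fun X => ?_
  have hX : X ∈ S := htop ▸ Submonoid.mem_top X
  obtain ⟨Y, hY, hYX⟩ := flowMonoid_subset_coe_image_reachableSet hA hB hX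
  rwa [← Subtype.ext hYX]

theorem flowMonoid_subset_specialUnitaryGroup {A B : Matrix (Fin N) (Fin N) ℂ} (hA : A ∈ su N)
    (hB : B ∈ su N) : (flowMonoid (Set.range fun c : ℝ => A + (c : ℂ) • B) :
      Set (Matrix (Fin N) (Fin N) ℂ)) ⊆ specialUnitaryGroup (Fin N) ℂ := by
  intro X hX
  obtain ⟨Y, -, rfl⟩ := flowMonoid_subset_coe_image_reachableSet hA hB hX
  exact Y.2

theorem star_mul_mul_mem_su {g v : Matrix (Fin N) (Fin N) ℂ}
    (hg : g ∈ specialUnitaryGroup (Fin N) ℂ) (hv : v ∈ su N) : star g * v * g ∈ su N := by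
  refine ⟨?_, ?_⟩
  · simp [star_eq_conjTranspose, hv.1, mul_assoc]
  · rw [trace_mul_cycle, Unitary.mul_star_self_of_mem hg.1, one_mul, hv.2]

attribute [local instance] LieRing.ofAssociativeRing

theorem lieSpan_pair_le_lieSpan_range (A B : Matrix (Fin N) (Fin N) ℂ) :
    LieSubalgebra.lieSpan ℝ (Matrix (Fin N) (Fin N) ℂ) {A, B} ≤
      LieSubalgebra.lieSpan ℝ _ (Set.range fun c : ℝ => A + (c : ℂ) • B) := by
  have hfield (c : ℝ) : A + (c : ℂ) • B ∈ LieSubalgebra.lieSpan ℝ (Matrix (Fin N) (Fin N) ℂ)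
      (Set.range fun c : ℝ => A + (c : ℂ) • B) := LieSubalgebra.subset_lieSpan ⟨c, rfl⟩
  rw [LieSubalgebra.lieSpan_le, Set.pair_subset_iff]
  exact ⟨by simpa using hfield 0, by simpa using LieSubalgebra.sub_mem _ (hfield 1) (hfield 0)⟩

theorem controllable_of_su_subset_lieSpan {A B : Matrix (Fin N) (Fin N) ℂ} (hA : A ∈ su N)
    (hB : B ∈ su N) (hL : su N ⊆ LieSubalgebra.lieSpan ℝ (Matrix (Fin N) (Fin N) ℂ) {A, B}) :
    Controllable A B := by
  have hflow := flowMonoid_subset_specialUnitaryGroup hA hB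
  obtain ⟨g, T, hT, hconj⟩ := exists_hasTangent_forall_lieSpan_conj_mem
    (Set.range fun c : ℝ => A + (c : ℂ) • B)
  let G : specialUnitaryGroup (Fin N) ℂ := ⟨g, hflow hT.mem⟩
  have hinv : (↑g⁻¹ : Matrix (Fin N) (Fin N) ℂ) = star (g : Matrix (Fin N) (Fin N) ℂ) :=
    Units.inv_eq_of_mul_eq_one_right (Unitary.mul_star_self_of_mem G.2.1)
  have hsu (v : Matrix (Fin N) (Fin N) ℂ) (hskew : star v = -v) (htr : v.trace = 0) : v ∈ T := by
    have hmem := hconj _ <| lieSpan_pair_le_lieSpan_range A B <|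
      hL (star_mul_mul_mem_su G.2 ⟨hskew, htr⟩)
    rwa [← hinv, ← mul_assoc, Units.mul_inv_cancel_left, mul_assoc, Units.mul_inv,
      mul_one] at hmem
  refine controllable_of_flowMonoid_mem_nhds hA hB (g := G) ?_
  rw [← map_mul_right_nhds_one G, eventually_map]
  exact (eventually_nhds_subtype_iff _ (1 : specialUnitaryGroup (Fin N) ℂ) _).2
    (hT.eventually_mul_mem hflow hsu)

theorem mainTheorem5_general (E : realCartan N) {B : Matrix (Fin N) (Fin N) ℂ} (hB : B ∈ su N)
    (hconn : (touchedRegularGraph E B).Preconnected) : Controllable (drift E) B :=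
  controllable_of_su_subset_lieSpan (drift_mem_su E) hB <|
    su_subset_of_preconnected (LieSubalgebra.subset_lieSpan (Set.mem_insert _ _))
      (LieSubalgebra.subset_lieSpan (Set.mem_insert_of_mem _ rfl)) hB.1 hconn

end Controllability

end QControl

theorem mainTheorem5 (N : ℕ) (E : QControl.realCartan N) (hE : Monotone (E : Fin N → ℝ))
    (B : Matrix (Fin N) (Fin N) ℂ) (hB : B ∈ QControl.su N)
    (hΦ : QControl.fundamentalRoots N ⊆ QControl.touchedRegularRoots E B) :
    QControl.Controllable (QControl.drift E) B :=
  QControl.mainTheorem5_general E hB (QControl.preconnected_touchedRegularGraph hΦ)
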